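/- Let $m,n$ be natural numbers, write $[k]=\{1,\dots,k\}$, and let $c_j\ge 0$ ($j\in[n]$, capacities) and $d_{ij}\ge 0$ ($i\in[m]$, $j\in[n]$, demands) be real numbers. Let $\chi^L$ be the set of all triples $[x,y,q]\in\mathbb{R}^{m\times n}\times\mathbb{R}^{n}\times\mathbb{R}^{m\times n}$ such that $$\sum_{i=1}^m x_{ij}\le c_jy_j\ \ \forall j\in[n],\qquad \sum_{j=1}^n x_{ij}\le\sum_{j=1}^n d_{ij}q_{ij}\ \ \forall i\in[m],\qquad \sum_{j=1}^n q_{ij}\le 1\ \ \forall i\in[m],$$ $$q_{ij}\le y_j,\qquad x_{ij}\ge 0,\qquad q_{ij}\ge 0,\qquad y_j\in\{0,1\}\qquad\forall i\in[m],\ \forall j\in[n].$$ Let $I\subseteq[m]$ and $J\subseteq[n]$ satisfy the three conditions $$\sum_{j\in J}c_j>\sum_{i\in I}\max_{j\in J}d_{ij},\qquad \max_{j\in[n]}d_{ij}=\max_{j\in J}d_{ij}\ \ \forall i\in I,\qquad \sum_{j\in J\setminus\{j_0\}}c_j<\sum_{i\in I}\max_{j\in J\setminus\{j_0\}}d_{ij}\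 \ \forall j_0\in J,$$ where a maximum over the empty set is $0$. Then the inequality $$\sum_{i\in I}\sum_{j\in J}x_{ij}+\sum_{j\in J}\Big(\sum_{j'\in J\setminus\{j\}}c_{j'}-\sum_{i\in I}\max_{j'\in J}d_{ij'}\Big)y_j\le(|J|-1)\Big(\sum_{j\in J}c_j-\sum_{i\in I}\max_{j'\in J}d_{ij'}\Big)$$ is valid for $\mathrm{conv}(\chi^L)$ and defines a facet of it, i.e. the set of points of $\mathrm{conv}(\chi^L)$ that satisfy it with equality is nonempty and has dimension $\dim\mathrm{conv}(\chi^L)-1$. -/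

import Mathlib

noncomputable section

/-- The space of triples `[x, y, q]`: `z.1 i j` is `x_ij`, `z.2.1 j` is `y_j`, and `z.2.2 i j` is
`q_ij`, for customer sites `i` and candidate locations `j`. -/
abbrev LiftedPoint (m n : ℕ) : Type :=
  (Fin m → Fin n → ℝ) × (Fin n → ℝ) × (Fin m → Fin n → ℝ)

/-- The lifted mixed-binary set `χ^L` with capacities `c` and demands `d`. -/
def chiL {m n : ℕ} (c : Fin n → ℝ) (d : Fin m → Fin n → ℝ) : Set (LiftedPoint m n) :=
  {z | (∀ j, ∑ i, z.1 i j ≤ c j * z.2.1 j) ∧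
       (∀ i, ∑ j, z.1 i j ≤ ∑ j, d i j * z.2.2 i j) ∧
       (∀ i, ∑ j, z.2.2 i j ≤ 1) ∧
       (∀ i j, z.2.2 i j ≤ z.2.1 j) ∧
       (∀ i j, 0 ≤ z.1 i j) ∧
       (∀ i j, 0 ≤ z.2.2 i j) ∧
       (∀ j, z.2.1 j = 0 ∨ z.2.1 j = 1)}

/-- `max_{j ∈ J} d_ij`, the demand that site `i` generates when exactly the locations in `J` are
open; it is `0` when no location is open. -/
def maxDemand {m n : ℕ} (d : Fin m → Fin n → ℝ) (J : Finset (Fin n)) (i : Fin m) : ℝ :=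
  if h : J.Nonempty then J.sup' h (d i) else 0

/-- The affine dimension of a nonempty set: the dimension of the direction of its affine hull. -/
def affineDim {E : Type*} [AddCommGroup E] [Module ℝ E] (s : Set E) : ℕ :=
  Module.finrank ℝ (affineSpan ℝ s).direction

/-- The inequality `f z ≤ b` is valid for `P`. -/
def IsValidFor {E : Type*} (f : E → ℝ) (b : ℝ) (P : Set E) : Prop :=
  ∀ z ∈ P, f z ≤ b

/-- The linear inequality `f z ≤ b` defines a facet of the polytope `P`: it is valid for `P`, and
the face `{z ∈ P | f z = b}` is nonempty of dimension `dim P - 1`. -/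
def DefinesFacet {E : Type*} [AddCommGroup E] [Module ℝ E] (f : E → ℝ) (b : ℝ) (P : Set E) :
    Prop :=
  IsValidFor f b P ∧ {z ∈ P | f z = b}.Nonempty ∧
    affineDim {z ∈ P | f z = b} + 1 = affineDim P

end

/-! Write C for the total capacity of J and D for the sum over I of the maximal demands in J.
Summing over I and J, the left-hand side is ∑ x + (C - D) ∑ y - ∑ c y. If all of J is open, then ∑ x
≤ D; if some location of J is closed, then ∑ x ≤ ∑ c y and ∑ y ≤ |J| - 1. Either bound gives
validity.

For the facet, it suffices that every linear functional constant on the face is, on χ^L, a multiple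
of the left-hand side (`affineDim_face_add_one`). Equality of coefficients would be too much to ask:
x_ij vanishes on χ^L when c_j = 0 or site i has no demand, so the hull need not be full-dimensional.

The coefficients are found by moving inside the face from two kinds of tight points. In
`exists_tight_all_open` the demand of I is exhausted and every positive capacity is slack, so flow
can move between locations. In `exists_tight_one_closed` the remaining capacity of J is exhausted
and demand is slack, so flow can move between sites; `exists_maxDemand_erase_pos_pos` links the
sites that no single closure connects. Hence the relevant flow coefficients on I × J share one value
μ, and comparing the two kinds of points yields the coefficients of y. -/

open Filter Topology

/-! ### Codimension-one criterion and small steps -/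

/-- If every linear functional that is constant on the nonempty proper face `{z ∈ P | f z = b}` is
an affine function of `f` on `P`, then this face has codimension one in `P`. -/
theorem affineDim_face_add_one {E : Type*} [AddCommGroup E] [Module ℝ E] [FiniteDimensional ℝ E]
    {P : Set E} (f : E →ₗ[ℝ] ℝ) {b : ℝ} {z₀ p : E} (hz₀ : z₀ ∈ P) (hfz₀ : f z₀ = b)
    (hp : p ∈ P) (hfp : f p ≠ b)
    (H : ∀ (g : E →ₗ[ℝ] ℝ) (δ : ℝ), (∀ z ∈ P, f z = b → g z = δ) →
      ∃ μ : ℝ, ∀ z ∈ P, g z - δ = μ * (f z - b)) :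
    affineDim {z ∈ P | f z = b} + 1 = affineDim P := by
  unfold affineDim
  rw [direction_affineSpan, direction_affineSpan]
  set F : Set E := {z ∈ P | f z = b}
  have hz₀F : z₀ ∈ F := ⟨hz₀, hfz₀⟩
  have hker : vectorSpan ℝ F ≤ LinearMap.ker f := by
    rw [vectorSpan_eq_span_vsub_set_right ℝ hz₀F, Submodule.span_le]
    rintro _ ⟨z, hz, rfl⟩
    simp [hz.2, hfz₀]
  have hnot : p - z₀ ∉ vectorSpan ℝ F := by
    intro h
    have := hker h
    rw [LinearMap.mem_ker, map_sub, hfz₀, sub_eq_zero] at this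
    exact hfp this
  rw [← Submodule.finrank_sup_span_singleton hnot]
  suffices vectorSpan ℝ F ⊔ ℝ ∙ (p - z₀) = vectorSpan ℝ P by rw [this]
  apply le_antisymm
  · apply sup_le (vectorSpan_mono ℝ fun z hz => hz.1)
    rw [Submodule.span_singleton_le_iff_mem]
    exact vsub_mem_vectorSpan ℝ hp hz₀
  · rw [vectorSpan_eq_span_vsub_set_right ℝ hz₀, Submodule.span_le]
    rintro _ ⟨z, hz, rfl⟩
    by_contra hzn
    obtain ⟨g, hgz, hg⟩ := Submodule.exists_le_ker_of_notMem hzn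
    obtain ⟨μ, hμ⟩ := H g (g z₀) fun z' hz' hfz' => by
      have := hg (Submodule.mem_sup_left (vsub_mem_vectorSpan ℝ (⟨hz', hfz'⟩ : z' ∈ F) hz₀F))
      simpa [sub_eq_zero] using this
    have h1 : g p - g z₀ = 0 := by
      have := hg (Submodule.mem_sup_right (Submodule.mem_span_singleton_self (p - z₀)))
      simpa using this
    -- `g` agrees at `p` and `z₀` while `f` does not, so `g` must be constant on `P`, against `g (z
    -- - z₀) ≠ 0`.
    have hμ0 : μ = 0 := by
      have := hμ p hp
      rw [h1] at this
      exact (mul_eq_zero.1 this.symm).resolve_right (sub_ne_zero.2 hfp)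
    have := hμ z hz
    rw [hμ0, zero_mul] at this
    exact hgz (by simpa using this)

/-- A constraint survives a short step if the step does not increase its left side or if the
constraint is slack. -/
theorem eventually_add_mul_le {a b s : ℝ} (hab : a ≤ b) (h : s ≤ 0 ∨ a < b) :
    ∀ᶠ t : ℝ in 𝓝[>] 0, a + t * s ≤ b := by
  rcases h with h | h
  · filter_upwards [self_mem_nhdsWithin] with t ht
    have := mul_nonpos_of_nonneg_of_nonpos (le_of_lt ht) h
    linarith
  · have hc : Tendsto (fun t : ℝ => a + t * s) (𝓝[>] 0) (𝓝 (a + 0 * s)) :=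
      ((continuous_const.add (continuous_id.mul continuous_const)).tendsto 0).mono_left
        nhdsWithin_le_nhds
    rw [zero_mul, add_zero] at hc
    exact (hc.eventually_lt_const h).mono fun _ ht => ht.le

/-! ### Maximal demands -/

section MaxDemand

variable {m n : ℕ} {d : Fin m → Fin n → ℝ} {J K : Finset (Fin n)}

theorem exists_eq_maxDemand (hJ : J.Nonempty) (i : Fin m) : ∃ k ∈ J, d i k = maxDemand d J i := by
  obtain ⟨k, hk, h⟩ := Finset.exists_mem_eq_sup' hJ (d i)
  exact ⟨k, hk, by rw [maxDemand, dif_pos hJ, h]⟩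

theorem le_maxDemand {k : Fin n} (hk : k ∈ J) (i : Fin m) : d i k ≤ maxDemand d J i := by
  rw [maxDemand, dif_pos ⟨k, hk⟩]
  exact Finset.le_sup' (d i) hk

theorem maxDemand_nonneg (hd : ∀ i j, 0 ≤ d i j) (J : Finset (Fin n)) (i : Fin m) :
    0 ≤ maxDemand d J i := by
  rcases J.eq_empty_or_nonempty with rfl | hJ
  · simp [maxDemand]
  · obtain ⟨k, -, h⟩ := exists_eq_maxDemand (d := d) hJ i
    exact h ▸ hd i k

theorem maxDemand_mono (hd : ∀ i j, 0 ≤ d i j) (h : J ⊆ K) (i : Fin m) :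
    maxDemand d J i ≤ maxDemand d K i := by
  rcases J.eq_empty_or_nonempty with rfl | hJ
  · simpa [maxDemand] using maxDemand_nonneg hd K i
  · obtain ⟨k, hk, hk'⟩ := exists_eq_maxDemand (d := d) hJ i
    exact hk' ▸ le_maxDemand (h hk) i

theorem sum_mul_le_maxDemand {q : Fin n → ℝ} (hq : ∀ j, 0 ≤ q j)
    (hq1 : ∑ j, q j ≤ 1) (hd : ∀ i j, 0 ≤ d i j) (i : Fin m) :
    ∑ j, d i j * q j ≤ maxDemand d Finset.univ i :=
  calc ∑ j, d i j * q j ≤ ∑ j, maxDemand d Finset.univ i * q j :=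
        Finset.sum_le_sum fun j _ =>
          mul_le_mul_of_nonneg_right (le_maxDemand (Finset.mem_univ j) i) (hq j)
    _ = maxDemand d Finset.univ i * ∑ j, q j := by rw [Finset.mul_sum]
    _ ≤ maxDemand d Finset.univ i := mul_le_of_le_one_right (maxDemand_nonneg hd _ i) hq1

end MaxDemand

/-! ### Unit matrices and coordinates of linear functionals -/

section Unit

variable {m n : ℕ}

/-- The matrix whose only nonzero entry is a `1` at `(i, j)`. -/
abbrev unitEntry (i : Fin m) (j : Fin n) : Fin m → Fin n → ℝ := Pi.single i (Pi.single j 1)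

theorem unitEntry_apply (i a : Fin m) (j b : Fin n) :
    unitEntry i j a b = if a = i ∧ b = j then 1 else 0 := by
  by_cases h : a = i
  · subst h; simp [unitEntry, Pi.single_apply]
  · simp [unitEntry, h]

theorem sum_row_unitEntry (i a : Fin m) (j : Fin n) :
    ∑ b, unitEntry i j a b = if a = i then 1 else 0 := by
  by_cases h : a = i <;> simp [unitEntry_apply, h]

theorem sum_col_unitEntry (i : Fin m) (j b : Fin n) :
    ∑ a, unitEntry i j a b = if b = j then 1 else 0 := by
  by_cases h : b = j <;> simp [unitEntry_apply, h]

theorem linearMap_eq_sum_unitEntry (h : (Fin m → Fin n → ℝ) →ₗ[ℝ] ℝ) (x : Fin m → Fin n → ℝ) :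
    h x = ∑ i, ∑ j, x i j * h (unitEntry i j) := by
  have hx : x = ∑ i, ∑ j, x i j • unitEntry i j := by
    ext a b
    simp [Finset.sum_apply, unitEntry_apply, ite_and]
  conv_lhs => rw [hx]
  simp [map_sum]

theorem linearMap_liftedPoint_eq_sum (g : LiftedPoint m n →ₗ[ℝ] ℝ) (z : LiftedPoint m n) :
    g z = ∑ i, ∑ j, z.1 i j * g (unitEntry i j, 0, 0) + ∑ j, z.2.1 j * g (0, Pi.single j 1, 0) +
      ∑ i, ∑ j, z.2.2 i j * g (0, 0, unitEntry i j) := by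
  have hz : g z = g (z.1, 0, 0) + g (0, z.2.1, 0) + g (0, 0, z.2.2) := by
    rw [← map_add, ← map_add]; simp
  have h1 := linearMap_eq_sum_unitEntry (g ∘ₗ LinearMap.inl ℝ _ _) z.1
  have h3 := linearMap_eq_sum_unitEntry (g ∘ₗ LinearMap.inr ℝ _ _ ∘ₗ LinearMap.inr ℝ _ _) z.2.2
  have h2 := LinearMap.pi_apply_eq_sum_univ
    (g ∘ₗ LinearMap.inr ℝ _ _ ∘ₗ LinearMap.inl ℝ _ (Fin m → Fin n → ℝ)) z.2.1
  have hs : ∀ j : Fin n, (fun k => if j = k then (1 : ℝ) else 0) = Pi.single j 1 := fun j => by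
    ext k; simp [Pi.single_apply, eq_comm]
  simp only [LinearMap.comp_apply, LinearMap.inl_apply, LinearMap.inr_apply, hs,
    smul_eq_mul] at h1 h2 h3
  rw [hz, ← h2, ← h3, ← Prod.mk_zero_zero] at *
  rw [h1]

end Unit

/-! ### Moves that stay in χ^L -/

section Perturbation

variable {m n : ℕ} {c : Fin n → ℝ} {d : Fin m → Fin n → ℝ} {z : LiftedPoint m n}

theorem exists_add_smul_flow_mem_chiL (hz : z ∈ chiL c d) (w : Fin m → Fin n → ℝ)
    (hcol : ∀ j, ∑ i, w i j ≤ 0 ∨ ∑ i, z.1 i j < c j * z.2.1 j)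
    (hrow : ∀ i, ∑ j, w i j ≤ 0 ∨ ∑ j, z.1 i j < ∑ j, d i j * z.2.2 i j)
    (hpos : ∀ i j, 0 ≤ w i j ∨ 0 < z.1 i j) :
    ∃ t : ℝ, 0 < t ∧ z + t • ((w, 0, 0) : LiftedPoint m n) ∈ chiL c d := by
  obtain ⟨h1, h2, h3, h4, h5, h6, h7⟩ := hz
  have e1 : ∀ᶠ t : ℝ in 𝓝[>] 0, ∀ j, ∑ i, z.1 i j + t * ∑ i, w i j ≤ c j * z.2.1 j :=
    eventually_all.2 fun j => eventually_add_mul_le (h1 j) (hcol j)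
  have e2 : ∀ᶠ t : ℝ in 𝓝[>] 0, ∀ i, ∑ j, z.1 i j + t * ∑ j, w i j ≤ ∑ j, d i j * z.2.2 i j :=
    eventually_all.2 fun i => eventually_add_mul_le (h2 i) (hrow i)
  have e3 : ∀ᶠ t : ℝ in 𝓝[>] 0, ∀ i j, -z.1 i j + t * -w i j ≤ 0 :=
    eventually_all.2 fun i => eventually_all.2 fun j =>
      eventually_add_mul_le (neg_nonpos.2 (h5 i j)) (by simpa using hpos i j)
  obtain ⟨t, ⟨⟨e1, e2⟩, e3⟩, ht⟩ := (((e1.and e2).and e3).and self_mem_nhdsWithin).exists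
  refine ⟨t, ht, ?_, ?_, ?_, ?_, ?_, ?_, ?_⟩
  · simpa [Finset.sum_add_distrib, Finset.mul_sum] using e1
  · simpa [Finset.sum_add_distrib, Finset.mul_sum] using e2
  · simpa using h3
  · simpa using h4
  · intro i j
    have := e3 i j
    simp only [Prod.fst_add, Prod.smul_fst, Pi.add_apply, Pi.smul_apply, smul_eq_mul]
    linarith
  · simpa using h6
  · simpa using h7

/-- Demands are nonnegative, so raising an assignment only relaxes the demand constraint; the
smaller of the two slacks serves as step length. -/
theorem exists_add_smul_assign_mem_chiL (hd : ∀ i j, 0 ≤ d i j) (hz : z ∈ chiL c d)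
    {i : Fin m} {j : Fin n} (hrow : ∑ k, z.2.2 i k < 1) (hij : z.2.2 i j < z.2.1 j) :
    ∃ t : ℝ, 0 < t ∧ z + t • ((0, 0, unitEntry i j) : LiftedPoint m n) ∈ chiL c d := by
  obtain ⟨h1, h2, h3, h4, h5, h6, h7⟩ := hz
  have ht : 0 < min (1 - ∑ k, z.2.2 i k) (z.2.1 j - z.2.2 i j) :=
    lt_min (by linarith) (by linarith)
  set t := min (1 - ∑ k, z.2.2 i k) (z.2.1 j - z.2.2 i j)
  have ht1 : t ≤ 1 - ∑ k, z.2.2 i k := min_le_left _ _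
  have ht2 : t ≤ z.2.1 j - z.2.2 i j := min_le_right _ _
  have hq : ∀ a b, z.2.2 a b ≤ z.2.2 a b + t * unitEntry i j a b := fun a b => by
    rw [unitEntry_apply]; split_ifs <;> linarith
  refine ⟨t, ht, ?_, ?_, ?_, ?_, ?_, ?_, ?_⟩
  · simpa using h1
  · intro a
    simp only [Prod.fst_add, Prod.smul_fst, Prod.snd_add, Prod.smul_snd, smul_zero,
      Pi.add_apply, Pi.zero_apply, add_zero, Pi.smul_apply, smul_eq_mul]
    exact (h2 a).trans (Finset.sum_le_sum fun b _ => mul_le_mul_of_nonneg_left (hq a b) (hd a b))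
  · intro a
    simp only [Prod.snd_add, Prod.smul_snd, Pi.add_apply, Pi.smul_apply, smul_eq_mul,
      Finset.sum_add_distrib, ← Finset.mul_sum, sum_row_unitEntry]
    split_ifs with h
    · subst h; linarith
    · simpa using h3 a
  · intro a b
    simp only [Prod.fst_add, Prod.smul_fst, Prod.snd_add, Prod.smul_snd, smul_zero,
      Pi.add_apply, Pi.zero_apply, add_zero, Pi.smul_apply, smul_eq_mul, unitEntry_apply]
    split_ifs with h
    · obtain ⟨rfl, rfl⟩ := h; linarith
    · simpa using h4 a b
  · simpa using h5
  · intro a b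
    exact (h6 a b).trans (hq a b)
  · simpa using h7

/-- Since y is binary, this move has length exactly one and requires the location to be unused. -/
theorem sub_open_mem_chiL (hz : z ∈ chiL c d) {j : Fin n} (hy : z.2.1 j = 1)
    (hx : ∀ i, z.1 i j = 0) (hq : ∀ i, z.2.2 i j = 0) :
    z - ((0, Pi.single j 1, 0) : LiftedPoint m n) ∈ chiL c d := by
  obtain ⟨h1, h2, h3, h4, h5, h6, h7⟩ := hz
  have key : ∀ k, z.2.1 k - (Pi.single j 1 : Fin n → ℝ) k = if k = j then 0 else z.2.1 k := by
    intro k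
    split_ifs with h
    · subst h; simp [hy]
    · simp [h]
  refine ⟨fun k => ?_, ?_, ?_, fun i k => ?_, ?_, ?_, fun k => ?_⟩
  · simp only [Prod.fst_sub, Prod.snd_sub, Pi.sub_apply, Pi.zero_apply, sub_zero, key]
    split_ifs with h
    · subst h; simp [hx]
    · exact h1 k
  · simpa using h2
  · simpa using h3
  · simp only [Prod.fst_sub, Prod.snd_sub, Pi.sub_apply, Pi.zero_apply, sub_zero, key]
    split_ifs with h
    · subst h; simp [hq]
    · exact h4 i k
  · simpa using h5
  · simpa using h6
  · simp only [Prod.fst_sub, Prod.snd_sub, Pi.sub_apply, key]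
    split_ifs
    · exact Or.inl rfl
    · exact h7 k

end Perturbation

/-! ### Points with proportional flow -/

section ProportionalPoint

variable {m n : ℕ}

/-- The point in which the sites of `I` send flow to the locations of `K` in proportion to the
capacities `c j` and to the demands `d i (a i)`, the locations given by `y` are open, and each site
`i` is assigned to the location `a i` at level `θ`. -/
def proportionalPoint (c : Fin n → ℝ) (d : Fin m → Fin n → ℝ) (I : Finset (Fin m))
    (K : Finset (Fin n)) (y : Fin n → ℝ) (a : Fin m → Fin n) (θ ρ : ℝ) : LiftedPoint m n :=
  (fun i j => if i ∈ I ∧ j ∈ K then c j * (ρ * d i (a i)) else 0, y,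
    fun i j => if j = a i then θ else 0)

variable {c : Fin n → ℝ} {d : Fin m → Fin n → ℝ} {I : Finset (Fin m)} {K : Finset (Fin n)}
  {y : Fin n → ℝ} {a : Fin m → Fin n} {θ ρ : ℝ}

local notation "pt" => proportionalPoint c d I K y a θ ρ

theorem proportionalPoint_flow (i : Fin m) (j : Fin n) :
    (pt).1 i j = if i ∈ I ∧ j ∈ K then c j * (ρ * d i (a i)) else 0 := rfl

theorem proportionalPoint_open : (pt).2.1 = y := rfl

theorem proportionalPoint_assign (i : Fin m) (j : Fin n) :
    (pt).2.2 i j = if j = a i then θ else 0 := rfl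

theorem sum_proportionalPoint_assign (i : Fin m) : ∑ j, (pt).2.2 i j = θ := by
  simp [proportionalPoint_assign]

theorem sum_proportionalPoint_demand (i : Fin m) :
    ∑ j, d i j * (pt).2.2 i j = θ * d i (a i) := by
  simp [proportionalPoint_assign, mul_comm]

theorem sum_proportionalPoint_col (j : Fin n) :
    ∑ i, (pt).1 i j = if j ∈ K then c j * (ρ * ∑ i ∈ I, d i (a i)) else 0 := by
  by_cases h : j ∈ K
  · simp [proportionalPoint_flow, h, Finset.sum_ite_mem, Finset.mul_sum]
  · simp [proportionalPoint_flow, h]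

theorem sum_proportionalPoint_row (i : Fin m) :
    ∑ j, (pt).1 i j = if i ∈ I then ρ * (∑ j ∈ K, c j) * d i (a i) else 0 := by
  by_cases h : i ∈ I
  · simp only [proportionalPoint_flow, h, true_and, if_true, Finset.sum_ite_mem,
      Finset.univ_inter, ← Finset.sum_mul]
    ring
  · simp [proportionalPoint_flow, h]

theorem sum_proportionalPoint_total {J : Finset (Fin n)} (hK : K ⊆ J) :
    ∑ i ∈ I, ∑ j ∈ J, (pt).1 i j = (∑ j ∈ K, c j) * (ρ * ∑ i ∈ I, d i (a i)) := by
  rw [Finset.sum_mul, Finset.sum_comm, ← Finset.sum_subset hK]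
  · refine Finset.sum_congr rfl fun j hj => ?_
    rw [Finset.mul_sum, Finset.mul_sum]
    exact Finset.sum_congr rfl fun i hi => if_pos ⟨hi, hj⟩
  · exact fun j _ hj => Finset.sum_eq_zero fun i _ => if_neg fun hij => hj hij.2

/-- All columns of `K` use the same fraction of their capacity, bounded by `hρD`, and all rows of
`I` the same multiple of `d i (a i)`, bounded by `hρC`. Tightness or slack is thus decided by `ρ`
and `θ` alone. -/
theorem proportionalPoint_mem_chiL (hc : ∀ j, 0 ≤ c j) (hd : ∀ i j, 0 ≤ d i j)
    (hy : ∀ j, y j = 0 ∨ y j = 1) (hyK : ∀ j ∈ K, y j = 1) (hya : ∀ i, y (a i) = 1)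
    (hθ : 0 ≤ θ) (hθ1 : θ ≤ 1) (hρ : 0 ≤ ρ) (hρD : ρ * ∑ i ∈ I, d i (a i) ≤ 1)
    (hρC : ρ * ∑ j ∈ K, c j ≤ θ) : pt ∈ chiL c d := by
  have hy0 : ∀ j, 0 ≤ y j := fun j => by rcases hy j with h | h <;> simp [h]
  refine ⟨fun j => ?_, fun i => ?_, fun i => ?_, fun i j => ?_, fun i j => ?_, fun i j => ?_, hy⟩
  · rw [sum_proportionalPoint_col, proportionalPoint_open]
    split_ifs with h
    · rw [hyK j h]
      exact mul_le_mul_of_nonneg_left hρD (hc j)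
    · exact mul_nonneg (hc j) (hy0 j)
  · rw [sum_proportionalPoint_row, sum_proportionalPoint_demand]
    split_ifs
    · exact mul_le_mul_of_nonneg_right hρC (hd _ _)
    · exact mul_nonneg hθ (hd _ _)
  · rwa [sum_proportionalPoint_assign]
  · rw [proportionalPoint_assign, proportionalPoint_open]
    split_ifs with h
    · rwa [h, hya]
    · exact hy0 j
  · rw [proportionalPoint_flow]
    split_ifs
    · exact mul_nonneg (hc j) (mul_nonneg hρ (hd _ _))
    · exact le_rfl
  · rw [proportionalPoint_assign]
    split_ifs
    · exact hθ
    · exact le_rfl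

end ProportionalPoint

/-! ### Validity and tight points -/

section CoverInequality

variable {m n : ℕ}

/-- The left-hand side of the cover inequality, as a linear functional. -/
def coverLHS (c : Fin n → ℝ) (d : Fin m → Fin n → ℝ) (I : Finset (Fin m)) (J : Finset (Fin n)) :
    LiftedPoint m n →ₗ[ℝ] ℝ where
  toFun z := (∑ i ∈ I, ∑ j ∈ J, z.1 i j) +
    ∑ j ∈ J, ((∑ j' ∈ J.erase j, c j') - ∑ i ∈ I, maxDemand d J i) * z.2.1 j
  map_add' z w := by
    simp only [Prod.fst_add, Prod.snd_add, Pi.add_apply, Finset.sum_add_distrib, mul_add]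
    ring
  map_smul' t z := by
    simp only [Prod.smul_fst, Prod.smul_snd, Pi.smul_apply, smul_eq_mul, RingHom.id_apply,
      mul_add, Finset.mul_sum, mul_left_comm]

/-- The right-hand side of the cover inequality. -/
def coverRHS (c : Fin n → ℝ) (d : Fin m → Fin n → ℝ) (I : Finset (Fin m)) (J : Finset (Fin n)) :
    ℝ :=
  ((J.card : ℝ) - 1) * ((∑ j ∈ J, c j) - ∑ i ∈ I, maxDemand d J i)

/-- The hypotheses on the sets `I` and `J` that define the cover inequality. -/
structure IsCriticalPair (c : Fin n → ℝ) (d : Fin m → Fin n → ℝ) (I : Finset (Fin m))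
    (J : Finset (Fin n)) : Prop where
  cap_nonneg : ∀ j, 0 ≤ c j
  demand_nonneg : ∀ i j, 0 ≤ d i j
  surplus : ∑ i ∈ I, maxDemand d J i < ∑ j ∈ J, c j
  max_eq : ∀ i ∈ I, maxDemand d Finset.univ i = maxDemand d J i
  critical : ∀ j₀ ∈ J, ∑ j ∈ J.erase j₀, c j < ∑ i ∈ I, maxDemand d (J.erase j₀) i

variable {c : Fin n → ℝ} {d : Fin m → Fin n → ℝ} {I : Finset (Fin m)} {J : Finset (Fin n)}

theorem coverLHS_apply (z : LiftedPoint m n) :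
    coverLHS c d I J z = (∑ i ∈ I, ∑ j ∈ J, z.1 i j) +
      ((∑ j ∈ J, c j) - ∑ i ∈ I, maxDemand d J i) * ∑ j ∈ J, z.2.1 j -
      ∑ j ∈ J, c j * z.2.1 j := by
  rw [add_sub_assoc, Finset.mul_sum, ← Finset.sum_sub_distrib]
  refine congrArg₂ _ rfl (Finset.sum_congr rfl fun j hj => ?_)
  rw [Finset.sum_erase_eq_sub hj]
  ring

namespace IsCriticalPair

variable (h : IsCriticalPair c d I J)
include h

theorem nonempty : J.Nonempty := by
  rw [Finset.nonempty_iff_ne_empty]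
  rintro rfl
  simpa [maxDemand] using h.surplus

theorem erase_nonempty {j₀ : Fin n} (hj₀ : j₀ ∈ J) : (J.erase j₀).Nonempty := by
  rw [Finset.nonempty_iff_ne_empty]
  intro he
  simpa [maxDemand, he] using h.critical j₀ hj₀

theorem one_lt_card : 1 < J.card := by
  obtain ⟨j, hj⟩ := h.nonempty
  have := (h.erase_nonempty hj).card_pos
  rw [Finset.card_erase_of_mem hj] at this
  omega

theorem exists_mem_ne (k : Fin n) : ∃ j ∈ J, j ≠ k :=
  Finset.exists_mem_ne h.one_lt_card k

/-- Deleting `j` turns a surplus of capacity into a shortage although the maximal demands do not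
grow. -/
theorem cap_pos {j : Fin n} (hj : j ∈ J) : 0 < c j := by
  have h1 := h.critical j hj
  rw [Finset.sum_erase_eq_sub hj] at h1
  have h2 := Finset.sum_le_sum fun i (_ : i ∈ I) =>
    maxDemand_mono h.demand_nonneg (Finset.erase_subset j J) i
  linarith [h.surplus]

theorem sum_cap_pos : 0 < ∑ j ∈ J, c j := Finset.sum_pos (fun _ => h.cap_pos) h.nonempty

theorem coverLHS_le {z : LiftedPoint m n} (hz : z ∈ chiL c d) :
    coverLHS c d I J z ≤ coverRHS c d I J := by
  obtain ⟨h1, h2, h3, h4, h5, h6, h7⟩ := hz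
  rw [coverLHS_apply, coverRHS]
  have hs := h.surplus
  by_cases hy : ∀ j ∈ J, z.2.1 j = 1
  · have hx : ∑ i ∈ I, ∑ j ∈ J, z.1 i j ≤ ∑ i ∈ I, maxDemand d J i :=
      Finset.sum_le_sum fun i hi => by
        -- The site may be assigned outside `J`, so its row is bounded only by the maximum over all
        -- locations.
        rw [← h.max_eq i hi]
        exact ((Finset.sum_le_univ_sum_of_nonneg (h5 i)).trans (h2 i)).trans
          (sum_mul_le_maxDemand (h6 i) (h3 i) h.demand_nonneg i)
    have e1 : ∑ j ∈ J, z.2.1 j = J.card := by rw [Finset.sum_congr rfl hy]; simp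
    have e2 : ∑ j ∈ J, c j * z.2.1 j = ∑ j ∈ J, c j :=
      Finset.sum_congr rfl fun j hj => by rw [hy j hj, mul_one]
    rw [e1, e2]
    linarith
  · push Not at hy
    obtain ⟨j₀, hj₀, hy₀⟩ := hy
    replace hy₀ := (h7 j₀).resolve_right hy₀
    have hx : ∑ i ∈ I, ∑ j ∈ J, z.1 i j ≤ ∑ j ∈ J, c j * z.2.1 j := by
      rw [Finset.sum_comm]
      exact Finset.sum_le_sum fun j _ =>
        (Finset.sum_le_univ_sum_of_nonneg fun i => h5 i j).trans (h1 j)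
    have e1 : ∑ j ∈ J, z.2.1 j ≤ (J.card : ℝ) - 1 := by
      rw [← Finset.sum_erase J hy₀]
      have : ∑ j ∈ J.erase j₀, z.2.1 j ≤ ∑ j ∈ J.erase j₀, (1 : ℝ) :=
        Finset.sum_le_sum fun j _ => by rcases h7 j with h | h <;> simp [h]
      rwa [Finset.sum_const, Finset.card_erase_of_mem hj₀, nsmul_eq_mul, mul_one,
        Nat.cast_pred (Finset.card_pos.2 ⟨j₀, hj₀⟩)] at this
    have := mul_le_mul_of_nonneg_left e1 (sub_nonneg.2 hs.le)
    linarith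

theorem coverRHS_pos : 0 < coverRHS c d I J := by
  have : (1 : ℝ) < J.card := by exact_mod_cast h.one_lt_card
  exact mul_pos (by linarith) (by linarith [h.surplus])

/-- With `ρ = 1 / C` and `θ = 1` the rows of `I` are exhausted, while each column of `J` uses the
fraction D / C < 1 of its capacity. -/
theorem exists_tight_all_open : ∃ z ∈ chiL c d, coverLHS c d I J z = coverRHS c d I J ∧
    (∀ j, z.2.1 j = 1) ∧
    (∑ i ∈ I, ∑ j ∈ J, z.1 i j = ∑ i ∈ I, maxDemand d J i) ∧
    (∀ j, 0 < c j → ∑ i, z.1 i j < c j * z.2.1 j) ∧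
    (∀ i ∉ I, 0 < maxDemand d Finset.univ i → ∑ j, z.1 i j < ∑ j, d i j * z.2.2 i j) ∧
    ∀ i ∈ I, ∀ j ∈ J, 0 < maxDemand d Finset.univ i → 0 < z.1 i j := by
  have hne : (Finset.univ : Finset (Fin n)).Nonempty := h.nonempty.mono (Finset.subset_univ J)
  choose a _ ha using exists_eq_maxDemand (d := d) hne
  have hC := h.sum_cap_pos
  have hD : ∑ i ∈ I, d i (a i) = ∑ i ∈ I, maxDemand d J i :=
    Finset.sum_congr rfl fun i hi => by rw [ha, h.max_eq i hi]
  have hlt : (∑ j ∈ J, c j)⁻¹ * ∑ i ∈ I, d i (a i) < 1 := by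
    rw [hD, inv_mul_lt_one₀ hC]
    exact h.surplus
  have htot : ∑ i ∈ I, ∑ j ∈ J, (proportionalPoint c d I J (fun _ => 1) a 1
      (∑ j ∈ J, c j)⁻¹).1 i j = ∑ i ∈ I, maxDemand d J i := by
    rw [sum_proportionalPoint_total subset_rfl, mul_inv_cancel_left₀ hC.ne', hD]
  refine ⟨proportionalPoint c d I J (fun _ => 1) a 1 (∑ j ∈ J, c j)⁻¹,
    proportionalPoint_mem_chiL h.cap_nonneg h.demand_nonneg (by simp) (by simp) (by simp)
      zero_le_one le_rfl (inv_nonneg.2 hC.le) hlt.le (inv_mul_cancel₀ hC.ne').le, ?_,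
    fun _ => rfl, htot, fun j hj => ?_, fun i hi hp => ?_, fun i hi j hj hp => ?_⟩
  · rw [coverLHS_apply, coverRHS, htot, proportionalPoint_open]
    simp
    ring
  · rw [sum_proportionalPoint_col, proportionalPoint_open, mul_one]
    split_ifs
    · exact mul_lt_of_lt_one_right hj hlt
    · exact hj
  · rw [sum_proportionalPoint_row, if_neg hi, sum_proportionalPoint_demand, ha]
    linarith
  · rw [proportionalPoint_flow, if_pos ⟨hi, hj⟩, ha]
    exact mul_pos (h.cap_pos hj) (mul_pos (inv_pos.2 hC) hp)

theorem exists_tight_one_closed {j₀ : Fin n} (hj₀ : j₀ ∈ J) :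
    ∃ z ∈ chiL c d, coverLHS c d I J z = coverRHS c d I J ∧
    (∀ j, z.2.1 j = if j = j₀ then 0 else 1) ∧
    (∑ i ∈ I, ∑ j ∈ J, z.1 i j = ∑ j ∈ J.erase j₀, c j) ∧
    (∀ i, ∀ j ∉ J, z.1 i j = 0 ∧ z.2.2 i j = 0) ∧
    (∀ i, ∑ j, z.2.2 i j < 1) ∧ (∀ i j, j ≠ j₀ → z.2.2 i j < z.2.1 j) ∧
    (∀ i, 0 < maxDemand d (J.erase j₀) i → ∑ j, z.1 i j < ∑ j, d i j * z.2.2 i j) ∧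
    ∀ i ∈ I, ∀ j ∈ J.erase j₀, 0 < maxDemand d (J.erase j₀) i → 0 < z.1 i j := by
  -- Assigning only within `J.erase j₀` leaves the locations outside `J` unused, so that they can be
  -- closed.
  choose a haJ ha using exists_eq_maxDemand (d := d) (h.erase_nonempty hj₀)
  have hD : ∑ i ∈ I, d i (a i) = ∑ i ∈ I, maxDemand d (J.erase j₀) i :=
    Finset.sum_congr rfl fun i _ => ha i
  have hcrit := h.critical j₀ hj₀
  rw [← hD] at hcrit
  have hC0 : 0 ≤ ∑ j ∈ J.erase j₀, c j := Finset.sum_nonneg fun j _ => h.cap_nonneg j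
  have hDpos : 0 < ∑ i ∈ I, d i (a i) := hC0.trans_lt hcrit
  set ρ := (∑ i ∈ I, d i (a i))⁻¹ with hρ
  have hρpos : 0 < ρ := inv_pos.2 hDpos
  have hρD : ρ * ∑ i ∈ I, d i (a i) = 1 := inv_mul_cancel₀ hDpos.ne'
  -- The columns are saturated; the critical condition leaves room for a `θ` that makes both demand
  -- and assignment slack.
  obtain ⟨θ, hθC, hθ1⟩ : ∃ θ, ρ * ∑ j ∈ J.erase j₀, c j < θ ∧ θ < 1 :=
    exists_between ((inv_mul_lt_one₀ hDpos).2 hcrit)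
  have hθ : 0 < θ := (mul_nonneg hρpos.le hC0).trans_lt hθC
  set y : Fin n → ℝ := fun j => if j = j₀ then 0 else 1
  have hy1 : ∀ j, j ≠ j₀ → y j = 1 := fun j hj => if_neg hj
  have htot : ∑ i ∈ I, ∑ j ∈ J, (proportionalPoint c d I (J.erase j₀) y a θ ρ).1 i j =
      ∑ j ∈ J.erase j₀, c j := by
    rw [sum_proportionalPoint_total (Finset.erase_subset _ _), hρD, mul_one]
  refine ⟨proportionalPoint c d I (J.erase j₀) y a θ ρ,
    proportionalPoint_mem_chiL h.cap_nonneg h.demand_nonneg (fun j => ite_eq_or_eq _ _ _)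
      (fun j hj => hy1 j (Finset.ne_of_mem_erase hj))
      (fun i => hy1 _ (Finset.ne_of_mem_erase (haJ i))) hθ.le hθ1.le hρpos.le hρD.le hθC.le, ?_,
    fun _ => rfl, htot, fun i j hj => ⟨?_, ?_⟩, fun i => ?_, fun i j hj => ?_, fun i hp => ?_,
    fun i hi j hj hp => ?_⟩
  · have e1 : ∑ j ∈ J, y j = (J.card : ℝ) - 1 := by
      rw [← Finset.sum_erase J (if_pos rfl : y j₀ = 0),
        Finset.sum_congr rfl fun j hj => hy1 j (Finset.ne_of_mem_erase hj), Finset.sum_const,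
        Finset.card_erase_of_mem hj₀, nsmul_eq_mul, mul_one,
        Nat.cast_pred (Finset.card_pos.2 ⟨j₀, hj₀⟩)]
    have e2 : ∑ j ∈ J, c j * y j = ∑ j ∈ J.erase j₀, c j := by
      rw [← Finset.sum_erase J (by simp [y] : c j₀ * y j₀ = 0)]
      exact Finset.sum_congr rfl fun j hj => by rw [hy1 j (Finset.ne_of_mem_erase hj), mul_one]
    rw [coverLHS_apply, coverRHS, htot, proportionalPoint_open, e1, e2]
    ring
  · rw [proportionalPoint_flow, if_neg]
    exact fun hij => hj (Finset.mem_of_mem_erase hij.2)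
  · rw [proportionalPoint_assign, if_neg]
    rintro rfl
    exact hj (Finset.mem_of_mem_erase (haJ i))
  · rwa [sum_proportionalPoint_assign]
  · rw [proportionalPoint_assign, proportionalPoint_open, hy1 j hj]
    split_ifs
    · exact hθ1
    · exact zero_lt_one
  · rw [sum_proportionalPoint_row, sum_proportionalPoint_demand, ha]
    split_ifs
    · exact mul_lt_mul_of_pos_right hθC hp
    · exact mul_pos hθ hp
  · rw [proportionalPoint_flow, if_pos ⟨hi, hj⟩, ha]
    exact mul_pos (h.cap_pos (Finset.mem_of_mem_erase hj)) (mul_pos hρpos hp)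

end IsCriticalPair

end CoverInequality

/-! ### Coefficients of a functional constant on the face -/

section Coefficients

variable {m n : ℕ} {c : Fin n → ℝ} {d : Fin m → Fin n → ℝ} {I : Finset (Fin m)}
  {J : Finset (Fin n)} {g : LiftedPoint m n →ₗ[ℝ] ℝ} {δ : ℝ} {z : LiftedPoint m n}

theorem sum_sum_unitEntry (i : Fin m) (j : Fin n) :
    ∑ a ∈ I, ∑ b ∈ J, unitEntry i j a b = if i ∈ I ∧ j ∈ J then 1 else 0 := by
  simp only [unitEntry_apply, ite_and]
  by_cases hi : i ∈ I <;> by_cases hj : j ∈ J <;> simp [hi, hj]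

/-- Both `z` and a point `z + t • w` with `t > 0` lie on the face, so `g` cannot change along `w`.
-/
theorem apply_flow_eq_zero (hg : ∀ z ∈ chiL c d, coverLHS c d I J z = coverRHS c d I J → g z = δ)
    (hz : z ∈ chiL c d) (hzt : coverLHS c d I J z = coverRHS c d I J) {w : Fin m → Fin n → ℝ}
    (hw : ∑ i ∈ I, ∑ j ∈ J, w i j = 0)
    (hcol : ∀ j, ∑ i, w i j ≤ 0 ∨ ∑ i, z.1 i j < c j * z.2.1 j)
    (hrow : ∀ i, ∑ j, w i j ≤ 0 ∨ ∑ j, z.1 i j < ∑ j, d i j * z.2.2 i j)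
    (hpos : ∀ i j, 0 ≤ w i j ∨ 0 < z.1 i j) : g (w, 0, 0) = 0 := by
  obtain ⟨t, ht, hmem⟩ := exists_add_smul_flow_mem_chiL hz w hcol hrow hpos
  have h0 : coverLHS c d I J (w, 0, 0) = 0 := by simp [coverLHS_apply, hw]
  have := hg _ hmem (by rw [map_add, map_smul, h0, smul_zero, add_zero, hzt])
  rw [map_add, hg z hz hzt, map_smul, smul_eq_mul, add_eq_left] at this
  exact (mul_eq_zero.1 this).resolve_left ht.ne'

theorem apply_unitEntry_eq_zero
    (hg : ∀ z ∈ chiL c d, coverLHS c d I J z = coverRHS c d I J → g z = δ)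
    (hz : z ∈ chiL c d) (hzt : coverLHS c d I J z = coverRHS c d I J) {i : Fin m} {j : Fin n}
    (hij : ¬(i ∈ I ∧ j ∈ J)) (hcol : ∑ i, z.1 i j < c j * z.2.1 j)
    (hrow : ∑ j, z.1 i j < ∑ j, d i j * z.2.2 i j) : g (unitEntry i j, 0, 0) = 0 := by
  refine apply_flow_eq_zero hg hz hzt ?_ (fun b => ?_) (fun a => ?_) fun a b => Or.inl ?_
  · rw [sum_sum_unitEntry, if_neg hij]
  · rw [sum_col_unitEntry]
    by_cases hb : b = j
    · exact Or.inr (hb ▸ hcol)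
    · simp [hb]
  · rw [sum_row_unitEntry]
    by_cases ha : a = i
    · exact Or.inr (ha ▸ hrow)
    · simp [ha]
  · rw [unitEntry_apply]
    positivity

theorem apply_unitEntry_eq
    (hg : ∀ z ∈ chiL c d, coverLHS c d I J z = coverRHS c d I J → g z = δ)
    (hz : z ∈ chiL c d) (hzt : coverLHS c d I J z = coverRHS c d I J) {i i' : Fin m} {j j' : Fin n}
    (hi : i ∈ I) (hi' : i' ∈ I) (hj : j ∈ J) (hj' : j' ∈ J) (hx : 0 < z.1 i j)
    (hcol : j' = j ∨ ∑ i, z.1 i j' < c j' * z.2.1 j')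
    (hrow : i' = i ∨ ∑ j, z.1 i' j < ∑ j, d i' j * z.2.2 i' j) :
    g (unitEntry i' j', 0, 0) = g (unitEntry i j, 0, 0) := by
  have key : g (unitEntry i' j' - unitEntry i j, 0, 0) = 0 := by
    refine apply_flow_eq_zero hg hz hzt ?_ (fun b => ?_) (fun a => ?_) fun a b => ?_
    · simp only [Pi.sub_apply, Finset.sum_sub_distrib, sum_sum_unitEntry]
      simp [hi, hi', hj, hj']
    · simp only [Pi.sub_apply, Finset.sum_sub_distrib, sum_col_unitEntry]
      by_cases hb : b = j'
      · subst hb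
        exact hcol.imp (fun e => by simp [e]) id
      · rw [if_neg hb]
        left
        split_ifs <;> norm_num
    · simp only [Pi.sub_apply, Finset.sum_sub_distrib, sum_row_unitEntry]
      by_cases ha : a = i'
      · subst ha
        exact hrow.imp (fun e => by simp [e]) id
      · rw [if_neg ha]
        left
        split_ifs <;> norm_num
    · simp only [Pi.sub_apply, unitEntry_apply]
      by_cases hab : a = i ∧ b = j
      · exact Or.inr (by rwa [hab.1, hab.2])
      · left
        rw [if_neg hab]
        split_ifs <;> norm_num
  rw [← sub_eq_zero, ← map_sub, Prod.mk_sub_mk, sub_self]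
  exact key

theorem zero_mem_chiL : (0 : LiftedPoint m n) ∈ chiL c d := by
  simp [chiL]

namespace IsCriticalPair

variable (h : IsCriticalPair c d I J)
include h

theorem assign_coeff_eq_zero
    (hg : ∀ z ∈ chiL c d, coverLHS c d I J z = coverRHS c d I J → g z = δ) (i : Fin m)
    (j : Fin n) : g (0, 0, unitEntry i j) = 0 := by
  obtain ⟨j₀, hj₀, hne⟩ := h.exists_mem_ne j
  obtain ⟨z, hz, hzt, -, -, -, hq1, hqy, -, -⟩ := h.exists_tight_one_closed hj₀
  obtain ⟨t, ht, hmem⟩ :=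
    exists_add_smul_assign_mem_chiL h.demand_nonneg hz (hq1 i) (hqy i j hne.symm)
  have h0 : coverLHS c d I J (0, 0, unitEntry i j) = 0 := by simp [coverLHS_apply]
  have := hg _ hmem (by rw [map_add, map_smul, h0, smul_zero, add_zero, hzt])
  rw [map_add, hg z hz hzt, map_smul, smul_eq_mul, add_eq_left] at this
  exact (mul_eq_zero.1 this).resolve_left ht.ne'

theorem open_coeff_eq_zero
    (hg : ∀ z ∈ chiL c d, coverLHS c d I J z = coverRHS c d I J → g z = δ) {j : Fin n}
    (hj : j ∉ J) : g (0, Pi.single j 1, 0) = 0 := by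
  obtain ⟨j₀, hj₀⟩ := h.nonempty
  obtain ⟨z, hz, hzt, hy, -, hout, -⟩ := h.exists_tight_one_closed hj₀
  have hmem := sub_open_mem_chiL hz (j := j)
    (by rw [hy, if_neg]; rintro rfl; exact hj hj₀) (fun i => (hout i j hj).1)
    fun i => (hout i j hj).2
  have h0 : coverLHS c d I J (0, Pi.single j 1, 0) = 0 := by
    have hs : ∀ k ∈ J, (Pi.single j 1 : Fin n → ℝ) k = 0 := fun k hk =>
      Pi.single_eq_of_ne (by rintro rfl; exact hj hk) _
    have hs' : ∀ k ∈ J, c k * (Pi.single j 1 : Fin n → ℝ) k = 0 := fun k hk => by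
      rw [hs k hk, mul_zero]
    simp only [coverLHS_apply, Finset.sum_eq_zero hs, Finset.sum_eq_zero hs']
    simp
  have := hg _ hmem (by rw [map_sub, h0, sub_zero, hzt])
  rwa [map_sub, hg z hz hzt, sub_eq_self] at this

theorem exists_mem_maxDemand_erase_pos {i : Fin m} (hi : i ∈ I)
    (hp : 0 < maxDemand d Finset.univ i) : ∃ j₀ ∈ J, 0 < maxDemand d (J.erase j₀) i := by
  obtain ⟨k, hk, hdk⟩ := exists_eq_maxDemand (d := d) h.nonempty i
  obtain ⟨j₀, hj₀, hne⟩ := h.exists_mem_ne k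
  refine ⟨j₀, hj₀, lt_of_lt_of_le ?_ (le_maxDemand (Finset.mem_erase.2 ⟨hne.symm, hk⟩) i)⟩
  rwa [hdk, ← h.max_eq i hi]

/-- A site of `I` needs a point with slack demand, hence one location of `J` closed; the open column
`j` outside `J` is empty there. For a site outside `I` the all-open point has slack in both row and
column. -/
theorem flow_coeff_eq_zero
    (hg : ∀ z ∈ chiL c d, coverLHS c d I J z = coverRHS c d I J → g z = δ) {i : Fin m} {j : Fin n}
    (hij : ¬(i ∈ I ∧ j ∈ J)) (hcj : 0 < c j) (hp : 0 < maxDemand d Finset.univ i) :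
    g (unitEntry i j, 0, 0) = 0 := by
  by_cases hi : i ∈ I
  · have hj : j ∉ J := fun hj => hij ⟨hi, hj⟩
    obtain ⟨j₀, hj₀, hM⟩ := h.exists_mem_maxDemand_erase_pos hi hp
    obtain ⟨z, hz, hzt, hy, -, hout, -, -, hrow, -⟩ := h.exists_tight_one_closed hj₀
    refine apply_unitEntry_eq_zero hg hz hzt hij ?_ (hrow i hM)
    rw [Finset.sum_eq_zero fun i _ => (hout i j hj).1, hy, if_neg, mul_one]
    · exact hcj
    · rintro rfl
      exact hj hj₀
  · obtain ⟨z, hz, hzt, -, -, hcol, hrow, -⟩ := h.exists_tight_all_open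
    exact apply_unitEntry_eq_zero hg hz hzt hij (hcol j hcj) (hrow i hi hp)

theorem flow_coeff_row_eq
    (hg : ∀ z ∈ chiL c d, coverLHS c d I J z = coverRHS c d I J → g z = δ) {i : Fin m}
    {j j' : Fin n} (hi : i ∈ I) (hj : j ∈ J) (hj' : j' ∈ J)
    (hp : 0 < maxDemand d Finset.univ i) :
    g (unitEntry i j', 0, 0) = g (unitEntry i j, 0, 0) := by
  obtain ⟨z, hz, hzt, -, -, hcol, -, hpos⟩ := h.exists_tight_all_open
  exact apply_unitEntry_eq hg hz hzt hi hi hj hj' (hpos i hi j hj hp)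
    (Or.inr (hcol j' (h.cap_pos hj'))) (Or.inl rfl)

/-- With `j₀` closed, flow passes from one site to the other within an open column `k`, whose total
is unchanged. The row equality transfers the result from `k` to `j`, which may be `j₀` itself. -/
theorem flow_coeff_eq_of_erase
    (hg : ∀ z ∈ chiL c d, coverLHS c d I J z = coverRHS c d I J → g z = δ) {i i' : Fin m}
    {j j₀ : Fin n} (hi : i ∈ I) (hi' : i' ∈ I) (hj : j ∈ J) (hj₀ : j₀ ∈ J)
    (hM : 0 < maxDemand d (J.erase j₀) i) (hM' : 0 < maxDemand d (J.erase j₀) i') :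
    g (unitEntry i' j, 0, 0) = g (unitEntry i j, 0, 0) := by
  have hmono := fun k => maxDemand_mono h.demand_nonneg (Finset.subset_univ (J.erase j₀)) k
  obtain ⟨k, hk⟩ := h.erase_nonempty hj₀
  have hkJ := Finset.mem_of_mem_erase hk
  obtain ⟨z, hz, hzt, -, -, -, -, -, hrow, hpos⟩ := h.exists_tight_one_closed hj₀
  rw [h.flow_coeff_row_eq hg hi hkJ hj (hM.trans_le (hmono i)),
    h.flow_coeff_row_eq hg hi' hkJ hj (hM'.trans_le (hmono i'))]
  exact apply_unitEntry_eq hg hz hzt hi hi' hkJ hkJ (hpos i hi k hk hM) (Or.inl rfl)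
    (Or.inr (hrow i' hM'))

/-- Two locations of `J` cannot be separated: some site of `I` keeps a positive demand whichever of
the two is closed. -/
theorem exists_maxDemand_erase_pos_pos {j₀ j₁ : Fin n} (hj₀ : j₀ ∈ J) (hj₁ : j₁ ∈ J)
    (hne : j₀ ≠ j₁) :
    ∃ i ∈ I, 0 < maxDemand d (J.erase j₀) i ∧ 0 < maxDemand d (J.erase j₁) i := by
  by_contra! hcon
  have hd := h.demand_nonneg
  -- Without a common site, at most one of the two maxima is positive at each site, so the two sums
  -- add up to at most D. The critical conditions bound them below strictly by C - c_j₀ and by c_j₀,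
  -- whence C < D, against the surplus.
  have hle : ∑ i ∈ I, maxDemand d (J.erase j₀) i + ∑ i ∈ I, maxDemand d (J.erase j₁) i ≤
      ∑ i ∈ I, maxDemand d J i := by
    rw [← Finset.sum_add_distrib]
    refine Finset.sum_le_sum fun i hi => ?_
    have m₀ := maxDemand_mono hd (Finset.erase_subset j₀ J) i
    have m₁ := maxDemand_mono hd (Finset.erase_subset j₁ J) i
    rcases (maxDemand_nonneg hd (J.erase j₀) i).eq_or_lt with h0 | h0
    · rwa [← h0, zero_add]
    · linarith [hcon i hi h0]
  have k₀ := h.critical j₀ hj₀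
  have k₁ := h.critical j₁ hj₁
  have hpair : c j₀ ≤ ∑ j ∈ J.erase j₁, c j :=
    Finset.single_le_sum (fun j _ => h.cap_nonneg j) (Finset.mem_erase.2 ⟨hne, hj₀⟩)
  rw [Finset.sum_erase_eq_sub hj₀] at k₀
  linarith [h.surplus]

theorem exists_flow_coeff_eq
    (hg : ∀ z ∈ chiL c d, coverLHS c d I J z = coverRHS c d I J → g z = δ) :
    ∃ μ : ℝ, ∀ i ∈ I, ∀ j ∈ J, 0 < maxDemand d Finset.univ i →
      g (unitEntry i j, 0, 0) = μ := by
  have key : ∀ i ∈ I, ∀ i' ∈ I, ∀ j ∈ J, 0 < maxDemand d Finset.univ i →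
      0 < maxDemand d Finset.univ i' →
      g (unitEntry i' j, 0, 0) = g (unitEntry i j, 0, 0) := by
    intro i hi i' hi' j hj hp hp'
    obtain ⟨j₀, hj₀, hM⟩ := h.exists_mem_maxDemand_erase_pos hi hp
    obtain ⟨j₁, hj₁, hM'⟩ := h.exists_mem_maxDemand_erase_pos hi' hp'
    by_cases hne : j₀ = j₁
    · subst hne
      exact h.flow_coeff_eq_of_erase hg hi hi' hj hj₀ hM hM'
    · obtain ⟨k, hk, hk₀, hk₁⟩ := h.exists_maxDemand_erase_pos_pos hj₀ hj₁ hne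
      exact (h.flow_coeff_eq_of_erase hg hk hi' hj hj₁ hk₁ hM').trans
        (h.flow_coeff_eq_of_erase hg hi hk hj hj₀ hM hk₀)
  by_cases hex : ∃ i ∈ I, 0 < maxDemand d Finset.univ i
  · obtain ⟨i₀, hi₀, hp₀⟩ := hex
    obtain ⟨j₀, hj₀⟩ := h.nonempty
    refine ⟨g (unitEntry i₀ j₀, 0, 0), fun i hi j hj hp => ?_⟩
    rw [h.flow_coeff_row_eq hg hi hj₀ hj hp, key i₀ hi₀ i hi j₀ hj₀ hp₀ hp]
  · push Not at hex
    exact ⟨0, fun i hi j _ hp => absurd hp (hex i hi).not_gt⟩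

/-- These entries are exactly those whose coefficients in `g` are left undetermined; they contribute
nothing on χ^L. -/
theorem flow_eq_zero (hz : z ∈ chiL c d) {i : Fin m} {j : Fin n}
    (hcd : ¬(0 < c j ∧ 0 < maxDemand d Finset.univ i)) : z.1 i j = 0 := by
  obtain ⟨h1, h2, h3, h4, h5, h6, h7⟩ := hz
  refine le_antisymm ?_ (h5 i j)
  by_cases hcj : 0 < c j
  · have hp := not_lt.1 fun hp => hcd ⟨hcj, hp⟩
    exact (((Finset.single_le_sum (fun k _ => h5 i k) (Finset.mem_univ j)).trans (h2 i)).trans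
      (sum_mul_le_maxDemand (h6 i) (h3 i) h.demand_nonneg i)).trans hp
  · have hc0 : c j = 0 := le_antisymm (not_lt.1 hcj) (h.cap_nonneg j)
    have := (Finset.single_le_sum (f := fun k => z.1 k j) (fun k _ => h5 k j)
      (Finset.mem_univ i)).trans (h1 j)
    rwa [hc0, zero_mul] at this

/-- On `χ^L`, a linear functional that is constant on the face of the cover inequality is a multiple
of the left-hand side of that inequality. -/
theorem exists_eq_mul_coverLHS
    (hg : ∀ z ∈ chiL c d, coverLHS c d I J z = coverRHS c d I J → g z = δ) :
    ∃ μ : ℝ, ∀ z ∈ chiL c d, g z = μ * coverLHS c d I J z := by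
  obtain ⟨μ, hμ⟩ := h.exists_flow_coeff_eq hg
  have hform : ∀ z ∈ chiL c d, g z = μ * ∑ i ∈ I, ∑ j ∈ J, z.1 i j +
      ∑ j ∈ J, z.2.1 j * g (0, Pi.single j 1, 0) := by
    intro z hz
    have hx : ∀ i j, z.1 i j * g (unitEntry i j, 0, 0) =
        if i ∈ I then (if j ∈ J then μ * z.1 i j else 0) else 0 := by
      intro i j
      by_cases hcd : 0 < c j ∧ 0 < maxDemand d Finset.univ i
      · rw [← ite_and]
        split_ifs with hij
        · rw [hμ i hij.1 j hij.2 hcd.2, mul_comm]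
        · rw [h.flow_coeff_eq_zero hg hij hcd.1 hcd.2, mul_zero]
      · simp [h.flow_eq_zero hz hcd]
    rw [linearMap_liftedPoint_eq_sum]
    simp only [hx, h.assign_coeff_eq_zero hg, mul_zero, Finset.sum_const_zero, add_zero]
    congr 1
    · simp [Finset.sum_ite_mem, Finset.mul_sum]
    · refine (Finset.sum_subset (Finset.subset_univ J) fun j _ hj => ?_).symm
      rw [h.open_coeff_eq_zero hg hj, mul_zero]
  have hβ : ∀ j ∈ J, g (0, Pi.single j 1, 0) =
      μ * ((∑ k ∈ J, c k) - ∑ i ∈ I, maxDemand d J i - c j) := by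
    intro j₀ hj₀
    obtain ⟨zA, hzA, htA, hyA, hxA, -⟩ := h.exists_tight_all_open
    obtain ⟨zB, hzB, htB, hyB, hxB, -⟩ := h.exists_tight_one_closed hj₀
    -- The two points differ in y only at `j₀`, and their flows over I × J total D and C - c_j₀,
    -- which isolates the coefficient of y at `j₀`.
    have e : g zA = g zB := (hg zA hzA htA).trans (hg zB hzB htB).symm
    rw [hform zA hzA, hform zB hzB, hxA, hxB, Finset.sum_erase_eq_sub hj₀,
      ← Finset.add_sum_erase J (fun j => zA.2.1 j * g _) hj₀,
      ← Finset.add_sum_erase J (fun j => zB.2.1 j * g _) hj₀] at e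
    have e' : ∑ j ∈ J.erase j₀, zB.2.1 j * g (0, Pi.single j 1, 0) =
        ∑ j ∈ J.erase j₀, zA.2.1 j * g (0, Pi.single j 1, 0) :=
      Finset.sum_congr rfl fun j hj => by
        rw [hyA, hyB, if_neg (Finset.ne_of_mem_erase hj)]
    rw [e', hyA, hyB, if_pos rfl] at e
    linarith
  refine ⟨μ, fun z hz => ?_⟩
  rw [hform z hz, coverLHS_apply, add_sub_assoc, mul_add, Finset.mul_sum J,
    ← Finset.sum_sub_distrib, Finset.mul_sum J]
  refine congrArg₂ _ rfl (Finset.sum_congr rfl fun j hj => ?_)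
  rw [hβ j hj]
  ring

theorem coverLHS_le_of_mem_convexHull {z : LiftedPoint m n} (hz : z ∈ convexHull ℝ (chiL c d)) :
    coverLHS c d I J z ≤ coverRHS c d I J :=
  convexHull_min (fun _ hz => h.coverLHS_le hz)
    (convex_halfSpace_le (coverLHS c d I J).isLinear _) hz

theorem definesFacet :
    DefinesFacet (coverLHS c d I J) (coverRHS c d I J) (convexHull ℝ (chiL c d)) := by
  obtain ⟨z₀, hz₀, htz₀, -⟩ := h.exists_tight_all_open
  have hsub := subset_convexHull ℝ (chiL c d)
  refine ⟨fun z => h.coverLHS_le_of_mem_convexHull, ⟨z₀, hsub hz₀, htz₀⟩, ?_⟩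
  -- The origin shows that the face is proper, because the right-hand side is positive.
  refine affineDim_face_add_one (coverLHS c d I J) (hsub hz₀) htz₀ (hsub zero_mem_chiL)
    (by rw [map_zero]; exact h.coverRHS_pos.ne) fun g δ hg => ?_
  have hg' : ∀ z ∈ chiL c d, coverLHS c d I J z = coverRHS c d I J → g z = δ :=
    fun z hz => hg z (hsub hz)
  obtain ⟨μ, hμ⟩ := h.exists_eq_mul_coverLHS hg'
  refine ⟨μ, fun z hz => ?_⟩
  have hz' : (g - μ • coverLHS c d I J) z = 0 :=
    convexHull_min (fun z hz => by simp [hμ z hz])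
      (convex_hyperplane (g - μ • coverLHS c d I J).isLinear 0) hz
  rw [LinearMap.sub_apply, LinearMap.smul_apply, smul_eq_mul, sub_eq_zero] at hz'
  rw [hz', ← hg' z₀ hz₀ htz₀, hμ z₀ hz₀, htz₀, mul_sub]

end IsCriticalPair

end Coefficients

theorem mainTheorem1 {m n : ℕ} (c : Fin n → ℝ) (d : Fin m → Fin n → ℝ)
    (hc : ∀ j, 0 ≤ c j) (hd : ∀ i j, 0 ≤ d i j)
    (I : Finset (Fin m)) (J : Finset (Fin n))
    (h_surplus : ∑ i ∈ I, maxDemand d J i < ∑ j ∈ J, c j)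
    (h_max : ∀ i ∈ I, maxDemand d Finset.univ i = maxDemand d J i)
    (h_critical : ∀ j₀ ∈ J, ∑ j ∈ J.erase j₀, c j < ∑ i ∈ I, maxDemand d (J.erase j₀) i) :
    IsValidFor
      (fun z : LiftedPoint m n => (∑ i ∈ I, ∑ j ∈ J, z.1 i j) +
        ∑ j ∈ J, ((∑ j' ∈ J.erase j, c j') - ∑ i ∈ I, maxDemand d J i) * z.2.1 j)
      (((J.card : ℝ) - 1) * ((∑ j ∈ J, c j) - ∑ i ∈ I, maxDemand d J i))
      (convexHull ℝ (chiL c d)) ∧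
    DefinesFacet
      (fun z : LiftedPoint m n => (∑ i ∈ I, ∑ j ∈ J, z.1 i j) +
        ∑ j ∈ J, ((∑ j' ∈ J.erase j, c j') - ∑ i ∈ I, maxDemand d J i) * z.2.1 j)
      (((J.card : ℝ) - 1) * ((∑ j ∈ J, c j) - ∑ i ∈ I, maxDemand d J i))
      (convexHull ℝ (chiL c d)) := by
  have h : IsCriticalPair c d I J := ⟨hc, hd, h_surplus, h_max, h_critical⟩
  exact ⟨fun _ => h.coverLHS_le_of_mem_convexHull, h.definesFacet⟩
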